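/- A time scale is a nonempty closed set $\mathbb{T}\subset\mathbb{R}$. Put $\sigma(t)=\inf\{s\in\mathbb{T}:s>t\}$, $\rho(t)=\sup\{s\in\mathbb{T}:s<t\}$ (with $\inf\emptyset=\sup\mathbb{T}$, $\sup\emptyset=\inf\mathbb{T}$) and $\mu(t)=\sigma(t)-t$; let $\mathbb{T}^{\kappa}=\mathbb{T}\setminus(\rho(\sup\mathbb{T}),\sup\mathbb{T}]$ if $\sup\mathbb{T}<\infty$ and $\mathbb{T}^\kappa=\mathbb{T}$ otherwise. For $f:\mathbb{T}\to\mathbb{R}$ and $t\in\mathbb{T}^\kappa$, $f^\Delta(t)$ is the number (if it exists) such that for every $\varepsilon>0$ there is $\delta>0$ with $|f(\sigma(t))-f(s)-f^\Delta(t)(\sigma(t)-s)|\le\varepsilon|\sigma(t)-s|$ for all $s\in(t-\delta,t+\delta)\cap\mathbb{T}$. The function $f$ is regulated if it has finite right-sided limits at all right-dense points ($\sigma(t)=t<\sup\mathbb{T}$) and finite left-sided limits at all left-dense points ($\rho(t)=t>\inf\mathbb{T}$); it is rd-continuous if it is continuous at all right-dense points and has finite left-sided limits at all left-dense points. For regulated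 $f$, $\int_a^b f(s)\,\Delta s=F(b)-F(a)$, where $F:\mathbb{T}\to\mathbb{R}$ is continuous and satisfies $F^\Delta=f$ on some $D\subset\mathbb{T}^\kappa$ such that $\mathbb{T}^\kappa\setminus D$ is countable and contains no $t$ with $\sigma(t)>t$. For rd-continuous $f$ with $1+\mu f\ne0$ on $\mathbb{T}$, $e_f(\cdot,t_0)$ is the unique solution of $x^\Delta=f(t)x$, $x(t_0)=1$ on $\mathbb{T}$. **Corollary 6.5.** Let $\mathbb{T}_1,\mathbb{T}_2$ be time scales, each containing $0$ and some positive number, and put $\mathbb{T}_i^+=[0,\infty)\cap\mathbb{T}_i$, which is again a time scale. Write $\Delta_i$ for the delta calculus on $\mathbb{T}_i^+$. Let $u,p,q,k:\mathbb{T}_1^+\times\mathbb{T}_2^+\to\mathbb{R}$ be continuous nonnegative functions. If $$u(t_1,t_2)\le p(t_1,t_2)+q(t_1,t_2)\int_0^{t_1}\int_0^{t_2}k(s_1,s_2)\,u(s_1,s_2)\,\Delta_2s_2\,\Delta_1s_1\qquad\text{for all }(t_1,t_2)\in\mathbb{T}_1^+\times\mathbb{T}_2^+,$$ then $$u(t_1,t_2)\le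 p(t_1,t_2)+q(t_1,t_2)\,A(t_1,t_2)\,e_{c}(t_1,0)\qquad\text{for all }(t_1,t_2)\in\mathbb{T}_1^+\times\mathbb{T}_2^+,$$ where $$a=kp,\qquad b=kq,\qquad A(t_1,t_2)=\int_0^{t_1}\int_0^{t_2}a(s_1,s_2)\,\Delta_2s_2\,\Delta_1s_1,\qquad c(t_1,t_2)=\int_0^{t_2}b(t_1,s_2)\,\Delta_2s_2,$$ and $e_c(t_1,0)$ is, for fixed $t_2$, the value at $t_1$ of the exponential function on $\mathbb{T}_1^+$ of the function $s_1\mapsto c(s_1,t_2)$. -/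

import Mathlib

open Set Filter Topology

noncomputable section

namespace TimeScale

/-- A time scale: a nonempty closed subset of `ℝ`. -/
def IsTimeScale (T : Set ℝ) : Prop := IsClosed T ∧ T.Nonempty

open Classical in
/-- The forward jump operator `σ(t) = inf {s ∈ T : s > t}`, with `inf ∅ = sup T`. -/
def forwardJump (T : Set ℝ) (t : ℝ) : ℝ :=
  if ({s ∈ T | t < s}).Nonempty then sInf {s ∈ T | t < s} else sSup T

open Classical in
/-- The backward jump operator `ρ(t) = sup {s ∈ T : s < t}`, with `sup ∅ = inf T`. -/
def backwardJump (T : Set ℝ) (t : ℝ) : ℝ :=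
  if ({s ∈ T | s < t}).Nonempty then sSup {s ∈ T | s < t} else sInf T

/-- The graininess `μ(t) = σ(t) - t`. -/
def graininess (T : Set ℝ) (t : ℝ) : ℝ := forwardJump T t - t

/-- `t` is right-scattered: `σ(t) > t`. -/
def RightScattered (T : Set ℝ) (t : ℝ) : Prop := t < forwardJump T t

/-- `t` is right-dense: `σ(t) = t` and `t < sup T` (the supremum may be `+∞`). -/
def RightDense (T : Set ℝ) (t : ℝ) : Prop := forwardJump T t = t ∧ ∃ s ∈ T, t < s

/-- `t` is left-dense: `ρ(t) = t` and `t > inf T` (the infimum may be `-∞`). -/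
def LeftDense (T : Set ℝ) (t : ℝ) : Prop := backwardJump T t = t ∧ ∃ s ∈ T, s < t

open Classical in
/-- `T^κ`: the set `T` without `(ρ(sup T), sup T]` if `sup T < ∞`, and `T` otherwise. -/
def kappa (T : Set ℝ) : Set ℝ :=
  if BddAbove T then T \ Ioc (backwardJump T (sSup T)) (sSup T) else T

/-- The number `d` is a delta (Hilger) derivative of `f : T → ℝ` at `t`.
Only the values of `f` on `T` matter. -/
def HasDeltaDerivAt (T : Set ℝ) (f : ℝ → ℝ) (d t : ℝ) : Prop :=
  ∀ ε > 0, ∃ δ > 0, ∀ s ∈ Ioo (t - δ) (t + δ) ∩ T, s ≠ forwardJump T t →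
    |f (forwardJump T t) - f s - d * (forwardJump T t - s)| ≤ ε * |forwardJump T t - s|

/-- Regulated functions: finite right-sided limits at right-dense points, finite left-sided limits
at left-dense points. -/
def Regulated (T : Set ℝ) (f : ℝ → ℝ) : Prop :=
  (∀ t ∈ T, RightDense T t → ∃ l : ℝ, Tendsto f (𝓝[T ∩ Ioi t] t) (𝓝 l)) ∧
  (∀ t ∈ T, LeftDense T t → ∃ l : ℝ, Tendsto f (𝓝[T ∩ Iio t] t) (𝓝 l))

/-- rd-continuous functions: continuous at right-dense points, with finite left-sided limits at
left-dense points. -/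
def RdContinuous (T : Set ℝ) (f : ℝ → ℝ) : Prop :=
  (∀ t ∈ T, RightDense T t → ContinuousWithinAt f T t) ∧
  (∀ t ∈ T, LeftDense T t → ∃ l : ℝ, Tendsto f (𝓝[T ∩ Iio t] t) (𝓝 l))

/-- Regressive functions: `1 + μ(t) f(t) ≠ 0` on `T`. -/
def Regressive (T : Set ℝ) (f : ℝ → ℝ) : Prop :=
  ∀ t ∈ T, 1 + graininess T t * f t ≠ 0

/-- `F` is pre-differentiable with some region of differentiation `D`, and `F^Δ = f` on `D`. -/
def IsPreAntiderivative (T : Set ℝ) (f F : ℝ → ℝ) : Prop :=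
  ContinuousOn F T ∧
    ∃ D ⊆ kappa T, (kappa T \ D).Countable ∧ (∀ t ∈ kappa T \ D, ¬ RightScattered T t) ∧
      ∀ t ∈ D, HasDeltaDerivAt T F (f t) t

open Classical in
/-- The Cauchy delta integral `∫_a^b f(s) Δs = F(b) - F(a)` of a regulated function `f`, where
`F` is a pre-antiderivative of `f` (it exists and is unique up to a constant). -/
def deltaIntegral (T : Set ℝ) (f : ℝ → ℝ) (a b : ℝ) : ℝ :=
  if h : Regulated T f ∧ ∃ F : ℝ → ℝ, IsPreAntiderivative T f F then
    Classical.choose h.2 b - Classical.choose h.2 a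
  else 0

/-- `x` solves the initial value problem `x^Δ = f(t) x`, `x(t₀) = 1` on `T`. -/
def IsExpSolution (T : Set ℝ) (f : ℝ → ℝ) (t₀ : ℝ) (x : ℝ → ℝ) : Prop :=
  x t₀ = 1 ∧ ∀ t ∈ kappa T, HasDeltaDerivAt T x (f t * x t) t

open Classical in
/-- The exponential function `e_f(t, t₀)` of an rd-continuous regressive function `f`: the value
at `t` of the solution (it exists and is unique on `T`) of `x^Δ = f(t) x`, `x(t₀) = 1`. -/
def deltaExp (T : Set ℝ) (f : ℝ → ℝ) (t t₀ : ℝ) : ℝ :=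
  if h : RdContinuous T f ∧ Regressive T f ∧ ∃ x : ℝ → ℝ, IsExpSolution T f t₀ x then
    Classical.choose h.2.2 t
  else 0

/-- `ℝ₊ ∩ T`. For a time scale `T` containing `0` this is again a time scale, and its forward jump
operator and graininess are the restrictions of those of `T`. -/
def nonnegPart (T : Set ℝ) : Set ℝ := Ici 0 ∩ T

end TimeScale

end

/-!
Extend a function `f` on a closed set `T` with least element `0` to the line by `f ∘ lastPoint T`,
that is, constantly across each gap. The delta integral of a continuous `f` is then the Lebesgue
integral of this extension (`TimeScale.deltaIntegral_eq_integral`). That the Lebesgue integral is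
a pre-antiderivative is a computation; that pre-antiderivatives are unique up to a constant
(`TimeScale.eq_of_hasDeltaDerivAt_zero`) follows from the fundamental theorem of calculus with a countable
exceptional set, since `T` has only countably many right-scattered points and a function with
vanishing delta derivative does not change across gaps.

The exponential function of `c ≥ 0` exists: it is the exponential of the integral of the cylinder
transformation `log (1 + μ c) / μ` (`TimeScale.isExpSolution_exp_integral`). Any solution `e` of
the initial value problem satisfies `e = 1 + ∫ c e`, which is all that is used of it.

For fixed `t₂`, let `z` be the double integral of `k u` as a function of `t₁`. Inserting the
hypothesis under the integral, and using that the double integral is nondecreasing in its second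
argument, gives `z^Δ ≤ α + c z`, where `α` is the inner integral of `k p`. Grönwall's inequality
(`TimeScale.integral_le_integral_mul_exp`) turns this into `z ≤ A e`: on `[0, t₁]` the difference
`z - A(t₁) e` is at most the integral of `c` times itself, so it is nonpositive.
-/

open MeasureTheory

namespace TimeScale

/-! ### Jump operators -/

variable {T : Set ℝ} {s t x y : ℝ}

theorem le_forwardJump (ht : t ∈ T) : t ≤ forwardJump T t := by
  unfold forwardJump
  split_ifs with h
  · exact le_csInf h fun b hb => hb.2.le
  · exact le_csSup ⟨t, fun b hb => not_lt.1 fun hlt => h ⟨b, hb, hlt⟩⟩ ht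

theorem forwardJump_le (hs : s ∈ T) (hts : t < s) : forwardJump T t ≤ s := by
  rw [forwardJump, if_pos ⟨s, hs, hts⟩]
  exact csInf_le ⟨t, fun b hb => hb.2.le⟩ ⟨hs, hts⟩

theorem forwardJump_eq_self_of_forall_le (ht : t ∈ T) (h : ∀ s ∈ T, s ≤ t) :
    forwardJump T t = t := by
  rw [forwardJump, if_neg (by rintro ⟨s, hs, hts⟩; exact (h s hs).not_gt hts)]
  exact IsGreatest.csSup_eq ⟨ht, h⟩

theorem forwardJump_mem (hT : IsClosed T) (ht : t ∈ T) : forwardJump T t ∈ T := by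
  by_cases h : ({s ∈ T | t < s}).Nonempty
  · rw [forwardJump, if_pos h]
    refine closure_minimal (fun b hb => hb.1) hT (csInf_mem_closure h ⟨t, fun b hb => hb.2.le⟩)
  · rw [forwardJump_eq_self_of_forall_le ht fun s hs => not_lt.1 fun hlt => h ⟨s, hs, hlt⟩]
    exact ht

theorem exists_mem_gt_of_rightScattered (ht : t ∈ T) (h : RightScattered T t) :
    ∃ s ∈ T, t < s := by
  by_contra! hn
  exact h.ne (forwardJump_eq_self_of_forall_le ht hn).symm

theorem forwardJump_mono : Monotone (forwardJump T) := by
  intro a b hab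
  by_cases hb : ({s ∈ T | b < s}).Nonempty
  · rw [forwardJump, forwardJump, if_pos hb, if_pos (Set.Nonempty.mono (t := {s ∈ T | a < s})
      (fun s hs => ⟨hs.1, hab.trans_lt hs.2⟩) hb)]
    exact csInf_le_csInf ⟨a, fun s hs => hs.2.le⟩ hb fun s hs => ⟨hs.1, hab.trans_lt hs.2⟩
  · have hbd : BddAbove T := ⟨b, fun s hs => not_lt.1 fun hlt => hb ⟨s, hs, hlt⟩⟩
    by_cases ha : ({s ∈ T | a < s}).Nonempty
    · rw [forwardJump, forwardJump, if_neg hb, if_pos ha]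
      obtain ⟨s, hs⟩ := ha
      exact (csInf_le ⟨a, fun s hs => hs.2.le⟩ hs).trans (le_csSup hbd hs.1)
    · rw [forwardJump, forwardJump, if_neg hb, if_neg ha]

theorem mem_kappa_of_lt (ht : t ∈ T) (hs : s ∈ T) (hts : t < s) : t ∈ kappa T := by
  unfold kappa
  split_ifs with hb
  · refine ⟨ht, fun h => ?_⟩
    have hlt : t < sSup T := hts.trans_le (le_csSup hb hs)
    rw [backwardJump, if_pos ⟨t, ht, hlt⟩] at h
    exact h.1.not_ge (le_csSup ⟨sSup T, fun b hb => hb.2.le⟩ ⟨ht, hlt⟩)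
  · exact ht

theorem mem_kappa_of_rightScattered (ht : t ∈ T) (h : RightScattered T t) : t ∈ kappa T := by
  obtain ⟨s, hs, hts⟩ := exists_mem_gt_of_rightScattered ht h
  exact mem_kappa_of_lt ht hs hts

theorem kappa_subset : kappa T ⊆ T := by
  unfold kappa
  split_ifs
  · exact sdiff_subset
  · exact subset_rfl

theorem diff_kappa_subsingleton : (T \ kappa T).Subsingleton := by
  rintro a ⟨ha, ha'⟩ b ⟨hb, hb'⟩
  refine le_antisymm (not_lt.1 fun h => hb' ?_) (not_lt.1 fun h => ha' ?_)
  · exact mem_kappa_of_lt hb ha h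
  · exact mem_kappa_of_lt ha hb h

/-- A point of `T` outside `T^κ` is a left-scattered maximum, hence an isolated point of `T`. -/
theorem continuousWithinAt_of_mem_diff_kappa {f : ℝ → ℝ} (ht : t ∈ T \ kappa T) :
    ContinuousWithinAt f T t := by
  have hmax : ∀ s ∈ T, s ≤ t := fun s hs => not_lt.1 fun h => ht.2 (mem_kappa_of_lt ht.1 hs h)
  have hsup : sSup T = t := IsGreatest.csSup_eq ⟨ht.1, hmax⟩
  have hbdd : BddAbove T := ⟨t, hmax⟩
  have hk := ht.2
  rw [kappa, if_pos hbdd, hsup] at hk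
  have hmem : t ∈ Ioc (backwardJump T t) t := by
    by_contra hc
    exact hk ⟨ht.1, hc⟩
  have hev : ∀ᶠ s in 𝓝[T] t, s = t := by
    filter_upwards [self_mem_nhdsWithin, mem_nhdsWithin_of_mem_nhds (Ioi_mem_nhds hmem.1)]
      with s hs hs'
    by_contra hne
    have hlt : s < t := lt_of_le_of_ne (hmax s hs) hne
    have h1 := hs'
    rw [backwardJump, if_pos ⟨s, hs, hlt⟩] at h1
    exact (not_le.2 h1) (le_csSup (s := {s ∈ T | s < t}) ⟨t, fun b hb => hb.2.le⟩ ⟨hs, hlt⟩)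
  refine (tendsto_const_nhds (x := f t)).congr' ?_
  filter_upwards [hev] with s hs
  rw [hs]

theorem countable_rightScattered : {t ∈ T | RightScattered T t}.Countable := by
  refine (countable_setOfPred_isolated_right_within (s := T)).mono ?_
  rintro t ⟨ht, h⟩
  refine ⟨ht, notMem_closure_iff_nhdsWithin_eq_bot.1 fun hcl => ?_⟩
  have : closure (T ∩ Ioi t) ⊆ Ici (forwardJump T t) :=
    closure_minimal (fun s hs => forwardJump_le hs.1 hs.2) isClosed_Ici
  exact h.not_ge (this hcl)

/-! ### Delta derivatives -/

variable {f g : ℝ → ℝ} {d d' : ℝ}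

theorem HasDeltaDerivAt.le_mul (h : HasDeltaDerivAt T f d t) {ε : ℝ} (hε : 0 < ε) :
    ∃ δ > 0, ∀ s ∈ Ioo (t - δ) (t + δ) ∩ T,
      |f (forwardJump T t) - f s - d * (forwardJump T t - s)| ≤ ε * |forwardJump T t - s| := by
  obtain ⟨δ, hδ, H⟩ := h ε hε
  refine ⟨δ, hδ, fun s hs => ?_⟩
  by_cases hst : s = forwardJump T t
  · simp [hst]
  · exact H s hs hst

theorem HasDeltaDerivAt.sub (hf : HasDeltaDerivAt T f d t) (hg : HasDeltaDerivAt T g d' t) :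
    HasDeltaDerivAt T (fun s => f s - g s) (d - d') t := by
  intro ε hε
  obtain ⟨δ₁, h₁, H₁⟩ := hf.le_mul (half_pos hε)
  obtain ⟨δ₂, h₂, H₂⟩ := hg.le_mul (half_pos hε)
  refine ⟨min δ₁ δ₂, lt_min h₁ h₂, fun s hs _ => ?_⟩
  have hm₁ := min_le_left δ₁ δ₂
  have hm₂ := min_le_right δ₁ δ₂
  have e₁ := H₁ s ⟨⟨by linarith [hs.1.1], by linarith [hs.1.2]⟩, hs.2⟩
  have e₂ := H₂ s ⟨⟨by linarith [hs.1.1], by linarith [hs.1.2]⟩, hs.2⟩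
  calc _ = |(f (forwardJump T t) - f s - d * (forwardJump T t - s))
        - (g (forwardJump T t) - g s - d' * (forwardJump T t - s))| := by congr 1; ring
    _ ≤ _ := abs_sub _ _
    _ ≤ _ := by linarith

/-- At a point that is not right-scattered, the delta derivative is the derivative within `T`. -/
theorem hasDeltaDerivAt_of_hasDerivWithinAt (hσ : forwardJump T t = t)
    (h : HasDerivWithinAt f d T t) : HasDeltaDerivAt T f d t := by
  intro ε hε
  have h' := (hasDerivWithinAt_iff_isLittleO.1 h).def hε
  obtain ⟨δ, hδ, H⟩ := Metric.mem_nhdsWithin_iff.1 h'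
  refine ⟨δ, hδ, fun s hs _ => ?_⟩
  have := H ⟨by rw [Real.ball_eq_Ioo]; exact hs.1, hs.2⟩
  simp only [mem_ofPred_eq, smul_eq_mul, Real.norm_eq_abs] at this
  rw [hσ, abs_sub_comm t s]
  refine le_trans (le_of_eq ?_) this
  rw [← abs_neg]
  congr 1
  ring

theorem hasDeltaDerivAt_of_rightScattered (hσ : RightScattered T t)
    (hc : ContinuousWithinAt f T t) (h : f (forwardJump T t) - f t = d * (forwardJump T t - t)) :
    HasDeltaDerivAt T f d t := by
  intro ε hε
  have hσ' : 0 < forwardJump T t - t := sub_pos.2 hσ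
  set m := forwardJump T t - t with hm
  have hφ : ContinuousWithinAt
      (fun s => ε * |forwardJump T t - s|
        - |f (forwardJump T t) - f s - d * (forwardJump T t - s)|) T t := by
    refine ContinuousWithinAt.sub ?_ (ContinuousWithinAt.abs ?_)
    · exact (by fun_prop : Continuous fun s => ε * |forwardJump T t - s|).continuousWithinAt
    · exact (continuousWithinAt_const.sub hc).sub
        (by fun_prop : Continuous fun s => d * (forwardJump T t - s)).continuousWithinAt
  have hpos : 0 < ε * |forwardJump T t - t|
        - |f (forwardJump T t) - f t - d * (forwardJump T t - t)| := by
    rw [h, ← hm, sub_self, abs_zero, sub_zero, abs_of_pos hσ']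
    positivity
  obtain ⟨δ, hδ, H⟩ := Metric.mem_nhdsWithin_iff.1 (hφ.eventually (lt_mem_nhds hpos))
  refine ⟨δ, hδ, fun s hs _ => ?_⟩
  have := H ⟨by rw [Real.ball_eq_Ioo]; exact hs.1, hs.2⟩
  simp only [mem_ofPred_eq] at this
  linarith

theorem HasDeltaDerivAt.sub_eq (ht : t ∈ T) (h : HasDeltaDerivAt T f d t) :
    f (forwardJump T t) - f t = d * (forwardJump T t - t) := by
  rw [← sub_eq_zero, ← abs_nonpos_iff]
  refine le_of_forall_pos_le_add fun ε hε => ?_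
  set m := |forwardJump T t - t|
  have hm : 0 ≤ m := abs_nonneg _
  obtain ⟨δ, hδ, H⟩ := h.le_mul (div_pos hε (by linarith : 0 < m + 1))
  refine (H t ⟨⟨by linarith, by linarith⟩, ht⟩).trans ?_
  rw [zero_add, div_mul_eq_mul_div, div_le_iff₀ (by linarith)]
  nlinarith

theorem HasDeltaDerivAt.continuousWithinAt (ht : t ∈ T) (h : HasDeltaDerivAt T f d t) :
    ContinuousWithinAt f T t := by
  have hjump := h.sub_eq ht
  rw [Metric.continuousWithinAt_iff]
  intro ε hε
  set m := |forwardJump T t - t|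
  have hm : 0 ≤ m := abs_nonneg _
  -- For `|s - t| < 1` the error is at most `η * (m + 1) ≤ ε / 2`.
  obtain ⟨δ, hδ, H⟩ := h.le_mul (div_pos hε (by linarith : 0 < 2 * (m + 1)))
  refine ⟨min δ (min 1 (ε / (2 * (|d| + 1)))), by positivity, fun {s} hs hst => ?_⟩
  rw [Real.dist_eq] at hst ⊢
  have h1 := hst.trans_le (min_le_left _ _)
  have h2 := hst.trans_le ((min_le_right _ _).trans (min_le_left _ _))
  have h3 := hst.trans_le ((min_le_right _ _).trans (min_le_right _ _))
  have e := H s ⟨⟨by linarith [(abs_lt.1 h1).1], by linarith [(abs_lt.1 h1).2]⟩, hs⟩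
  have e2 : |forwardJump T t - s| ≤ m + 1 := by
    calc |forwardJump T t - s| = |(forwardJump T t - t) - (s - t)| := by congr 1; ring
      _ ≤ m + |s - t| := abs_sub _ _
      _ ≤ m + 1 := by linarith
  have e3 : ε / (2 * (m + 1)) * |forwardJump T t - s| ≤ ε / 2 := by
    calc _ ≤ ε / (2 * (m + 1)) * (m + 1) := by gcongr
      _ = ε / 2 := by field_simp
  have e4 : |d| * |s - t| < ε / 2 := by
    rw [lt_div_iff₀ (by positivity)] at h3
    nlinarith [abs_nonneg d, abs_nonneg (s - t)]
  calc |f s - f t| = |-(f (forwardJump T t) - f s - d * (forwardJump T t - s))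
        + d * (s - t)| := by congr 1; linear_combination hjump
    _ ≤ _ := abs_add_le _ _
    _ = |f (forwardJump T t) - f s - d * (forwardJump T t - s)| + |d| * |s - t| := by
        rw [abs_neg, abs_mul]
    _ < ε := by linarith

/-! ### Delta integrals as Lebesgue integrals -/

/-- The last point of `T` that is at most `x`, for a closed `T` with least element `0`. For
negative `x` it is `0`, so that `lastPoint T` takes values in `T` on the whole line. -/
noncomputable def lastPoint (T : Set ℝ) (x : ℝ) : ℝ := sSup (T ∩ Iic (max x 0))

variable {a b : ℝ} {c F G H : ℝ → ℝ}

theorem lastPoint_isGreatest (hT : IsClosed T) (h0 : IsLeast T 0) (x : ℝ) :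
    IsGreatest (T ∩ Iic (max x 0)) (lastPoint T x) :=
  have hb : BddAbove (T ∩ Iic (max x 0)) := ⟨max x 0, fun _ hb => hb.2⟩
  ⟨(hT.inter isClosed_Iic).csSup_mem ⟨0, h0.1, le_max_right x 0⟩ hb, fun _ hs => le_csSup hb hs⟩

theorem lastPoint_mem (hT : IsClosed T) (h0 : IsLeast T 0) (x : ℝ) : lastPoint T x ∈ T :=
  (lastPoint_isGreatest hT h0 x).1.1

theorem lastPoint_nonneg (hT : IsClosed T) (h0 : IsLeast T 0) (x : ℝ) : 0 ≤ lastPoint T x :=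
  h0.2 (lastPoint_mem hT h0 x)

theorem lastPoint_le (hT : IsClosed T) (h0 : IsLeast T 0) (hx : 0 ≤ x) : lastPoint T x ≤ x := by
  simpa [max_eq_left hx] using (lastPoint_isGreatest hT h0 x).1.2

theorem le_lastPoint (hT : IsClosed T) (h0 : IsLeast T 0) (hs : s ∈ T) (hsx : s ≤ x) :
    s ≤ lastPoint T x :=
  (lastPoint_isGreatest hT h0 x).2 ⟨hs, hsx.trans (le_max_left _ _)⟩

theorem lastPoint_eq_self (hT : IsClosed T) (h0 : IsLeast T 0) (hs : s ∈ T) :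
    lastPoint T s = s :=
  le_antisymm (lastPoint_le hT h0 (h0.2 hs)) (le_lastPoint hT h0 hs le_rfl)

theorem lastPoint_mono (h0 : IsLeast T 0) : Monotone (lastPoint T) :=
  fun x y hxy => csSup_le_csSup ⟨max y 0, fun _ hb => hb.2⟩ ⟨0, h0.1, le_max_right x 0⟩
    (inter_subset_inter_right _ (Iic_subset_Iic.2 (max_le_max_right _ hxy)))

theorem lastPoint_eq_of_lt_forwardJump (hT : IsClosed T) (h0 : IsLeast T 0) (ht : t ∈ T)
    (htx : t ≤ x) (hx : x < forwardJump T t) : lastPoint T x = t := by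
  refine le_antisymm (not_lt.1 fun h => ?_) (le_lastPoint hT h0 ht htx)
  have h1 := forwardJump_le (lastPoint_mem hT h0 x) h
  exact ((lastPoint_le hT h0 ((h0.2 ht).trans htx)).trans_lt hx).not_ge h1

theorem lastPoint_eventuallyEq (hT : IsClosed T) (h0 : IsLeast T 0) (hx0 : 0 < x) (hx : x ∉ T) :
    lastPoint T =ᶠ[𝓝 x] fun _ => lastPoint T x := by
  obtain ⟨δ, hδ, hsub⟩ := Metric.isOpen_iff.1 hT.isOpen_compl x hx
  filter_upwards [Metric.ball_mem_nhds x hδ, Ioi_mem_nhds hx0] with y hy hy0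
  rw [Real.ball_eq_Ioo] at hy hsub
  have key : ∀ s ∈ T, s ≤ x - δ ∨ x + δ ≤ s := fun s hs => by
    by_contra! hc
    exact hsub ⟨hc.1, hc.2⟩ hs
  have hy1 := lastPoint_le hT h0 (le_of_lt hy0)
  have hx1 := lastPoint_le hT h0 hx0.le
  refine le_antisymm ?_ ?_
  · refine le_lastPoint hT h0 (lastPoint_mem hT h0 y) ?_
    rcases key _ (lastPoint_mem hT h0 y) with h | h <;> linarith [hy.2]
  · refine le_lastPoint hT h0 (lastPoint_mem hT h0 x) ?_
    rcases key _ (lastPoint_mem hT h0 x) with h | h <;> linarith [hy.1]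

theorem measurable_comp_lastPoint (hT : IsClosed T) (h0 : IsLeast T 0) (hf : ContinuousOn f T) :
    Measurable fun x => f (lastPoint T x) := by
  have h1 : Measurable fun x => (⟨lastPoint T x, lastPoint_mem hT h0 x⟩ : T) :=
    (lastPoint_mono h0).measurable.subtype_mk
  exact (continuousOn_iff_continuous_domRestrict.1 hf).measurable.comp h1

theorem intervalIntegrable_of_abs_le (hT : IsClosed T) (h0 : IsLeast T 0)
    (hm : Measurable fun x => f (lastPoint T x)) (hG : ContinuousOn G T)
    (hle : ∀ s ∈ T, |f s| ≤ G s) (a b : ℝ) :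
    IntervalIntegrable (fun x => f (lastPoint T x)) volume a b := by
  obtain ⟨C, hC⟩ := ((isCompact_Icc (a := 0) (b := max (max a b) 0)).inter_left hT)
    |>.exists_bound_of_continuousOn (hG.mono inter_subset_left)
  refine (intervalIntegrable_const (c := C)).mono_fun hm.aestronglyMeasurable ?_
  refine (ae_restrict_mem measurableSet_uIoc).mono fun x hx => ?_
  have hmem := lastPoint_mem hT h0 x
  have hub : lastPoint T x ≤ max (max a b) 0 :=
    (lastPoint_isGreatest hT h0 x).1.2.trans (max_le_max_right _ hx.2)
  have h1 := hC _ ⟨hmem, lastPoint_nonneg hT h0 x, hub⟩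
  refine (hle _ hmem).trans ((le_abs_self _).trans (h1.trans (le_abs_self _)))

theorem intervalIntegrable_comp_lastPoint (hT : IsClosed T) (h0 : IsLeast T 0)
    (hf : ContinuousOn f T) (a b : ℝ) :
    IntervalIntegrable (fun x => f (lastPoint T x)) volume a b :=
  intervalIntegrable_of_abs_le hT h0 (measurable_comp_lastPoint hT h0 hf) hf.abs
    (fun _ _ => le_rfl) a b

theorem integral_forwardJump (hT : IsClosed T) (h0 : IsLeast T 0) (ht : t ∈ T) (f : ℝ → ℝ) :
    ∫ x in t..forwardJump T t, f (lastPoint T x) = f t * (forwardJump T t - t) := by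
  have hle := le_forwardJump ht
  have : ∫ x in t..forwardJump T t, f (lastPoint T x) = ∫ x in t..forwardJump T t, f t := by
    rw [intervalIntegral.integral_of_le hle, intervalIntegral.integral_of_le hle,
      ← integral_Ico_eq_integral_Ioc, ← integral_Ico_eq_integral_Ioc]
    refine setIntegral_congr_fun measurableSet_Ico fun x hx => ?_
    simp only [lastPoint_eq_of_lt_forwardJump hT h0 ht hx.1 hx.2]
  rw [this, intervalIntegral.integral_const, smul_eq_mul, mul_comm]

theorem continuous_integral_lastPoint
    (hi : ∀ a b, IntervalIntegrable (fun x => f (lastPoint T x)) volume a b) :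
    Continuous fun t => ∫ x in (0 : ℝ)..t, f (lastPoint T x) :=
  intervalIntegral.continuous_primitive hi 0

/-- Only continuity of `f` at `t` *within* `T` is needed: between two points of `T`, the values of
`lastPoint T` are points of `T` between them. -/
theorem hasDerivWithinAt_integral_lastPoint (hT : IsClosed T) (h0 : IsLeast T 0)
    (hi : ∀ a b, IntervalIntegrable (fun x => f (lastPoint T x)) volume a b)
    (ht : t ∈ T) (hf : ContinuousWithinAt f T t) :
    HasDerivWithinAt (fun t => ∫ x in (0 : ℝ)..t, f (lastPoint T x)) (f t) T t := by
  rw [hasDerivWithinAt_iff_isLittleO, Asymptotics.isLittleO_iff]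
  intro ε hε
  obtain ⟨δ, hδ, hd⟩ := Metric.continuousWithinAt_iff.1 hf ε hε
  filter_upwards [self_mem_nhdsWithin, mem_nhdsWithin_of_mem_nhds (Metric.ball_mem_nhds t hδ)]
    with s hs hst
  rw [intervalIntegral.integral_interval_sub_left (hi _ _) (hi _ _)]
  have hconst : (s - t) • f t = ∫ x in t..s, f t := by rw [intervalIntegral.integral_const]
  rw [hconst, ← intervalIntegral.integral_sub (hi _ _) intervalIntegrable_const]
  refine intervalIntegral.norm_integral_le_of_norm_le_const fun x hx => ?_
  have hx' := uIoc_subset_uIcc hx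
  have h2 : lastPoint T x ∈ uIcc t s := by
    have h1 := (lastPoint_mono h0).image_uIcc_subset (mem_image_of_mem _ hx')
    rwa [lastPoint_eq_self hT h0 ht, lastPoint_eq_self hT h0 hs] at h1
  have h3 : dist (lastPoint T x) t < δ :=
    ((Real.dist_le_of_mem_uIcc h2 left_mem_uIcc).trans_eq (dist_comm _ _)).trans_lt hst
  exact (hd (lastPoint_mem hT h0 x) h3).le

theorem hasDeltaDerivAt_integral (hT : IsClosed T) (h0 : IsLeast T 0) (hf : ContinuousOn f T)
    (ht : t ∈ T) :
    HasDeltaDerivAt T (fun t => ∫ x in (0 : ℝ)..t, f (lastPoint T x)) (f t) t := by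
  have hi := intervalIntegrable_comp_lastPoint hT h0 hf
  rcases (le_forwardJump ht).eq_or_lt with h | h
  · exact hasDeltaDerivAt_of_hasDerivWithinAt h.symm
      (hasDerivWithinAt_integral_lastPoint hT h0 hi ht (hf t ht))
  · refine hasDeltaDerivAt_of_rightScattered h
      (continuous_integral_lastPoint hi).continuousWithinAt ?_
    rw [intervalIntegral.integral_interval_sub_left (hi _ _) (hi _ _),
      integral_forwardJump hT h0 ht]

/-- If `H` does not change across the gaps of `T`, its value at `lastPoint T y` is attained at a
point of `T` that is at least as close to `x ∈ T` as `y` is: one of the two ends of the gap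
that contains `y`. -/
theorem exists_mem_eq_lastPoint (hT : IsClosed T) (h0 : IsLeast T 0)
    (hH : ∀ t ∈ T, H (forwardJump T t) = H t) (hx : x ∈ T) (y : ℝ) :
    ∃ z ∈ T, H (lastPoint T y) = H z ∧ |z - x| ≤ |y - x| := by
  have hx0 : 0 ≤ x := h0.2 hx
  by_cases hy : y ∈ T
  · exact ⟨y, hy, by rw [lastPoint_eq_self hT h0 hy], le_rfl⟩
  rcases le_or_gt x y with hxy | hxy
  · refine ⟨_, lastPoint_mem hT h0 y, rfl, ?_⟩
    have h1 := le_lastPoint hT h0 hx hxy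
    have h2 := lastPoint_le hT h0 (hx0.trans hxy)
    rw [abs_of_nonneg (by linarith), abs_of_nonneg (by linarith)]
    linarith
  rcases le_or_gt 0 y with hy0 | hy0
  · refine ⟨_, forwardJump_mem hT (lastPoint_mem hT h0 y), (hH _ (lastPoint_mem hT h0 y)).symm, ?_⟩
    have h1 := forwardJump_le hx ((lastPoint_le hT h0 hy0).trans_lt hxy)
    have h2 : y ≤ forwardJump T (lastPoint T y) := by
      have hne : ({s ∈ T | lastPoint T y < s}).Nonempty :=
        ⟨x, hx, (lastPoint_le hT h0 hy0).trans_lt hxy⟩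
      rw [forwardJump, if_pos hne]
      refine le_csInf hne fun s hs => not_lt.1 fun hlt => ?_
      exact hs.2.not_ge (le_lastPoint hT h0 hs.1 hlt.le)
    rw [abs_of_nonpos (by linarith), abs_of_nonpos (by linarith)]
    linarith
  · refine ⟨_, lastPoint_mem hT h0 y, rfl, ?_⟩
    have h1 := lastPoint_nonneg hT h0 y
    have h2 : lastPoint T y ≤ x := by
      have := lastPoint_mono h0 hxy.le
      rwa [lastPoint_eq_self hT h0 hx] at this
    rw [abs_of_nonpos (by linarith), abs_of_nonpos (by linarith)]
    linarith

/-- A continuous function on `T` whose delta derivative vanishes off a countable set without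
right-scattered points is constant on `T`: extended by `lastPoint`, it is continuous and has
derivative zero off a countable set. -/
theorem eq_of_hasDeltaDerivAt_zero (hT : IsClosed T) (h0 : IsLeast T 0) (hc : ContinuousOn H T)
    {D : Set ℝ} (hD : (kappa T \ D).Countable) (hDs : ∀ t ∈ kappa T \ D, ¬ RightScattered T t)
    (hd : ∀ t ∈ D, HasDeltaDerivAt T H 0 t) (ha : a ∈ T) (hb : b ∈ T) : H b = H a := by
  have hH : ∀ t ∈ T, H (forwardJump T t) = H t := by
    intro t ht
    rcases (le_forwardJump ht).eq_or_lt with h | h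
    · rw [← h]
    · have htD : t ∈ D := by
        by_contra htD
        exact hDs t ⟨mem_kappa_of_rightScattered ht h, htD⟩ h
      have := (hd t htD).sub_eq ht
      linarith
  have hcont : ∀ x ∈ T, ContinuousAt (fun y => H (lastPoint T y)) x := by
    intro x hx
    rw [Metric.continuousAt_iff]
    intro ε hε
    obtain ⟨δ, hδ, h⟩ := Metric.continuousWithinAt_iff.1 (hc x hx) ε hε
    refine ⟨δ, hδ, fun {y} hy => ?_⟩
    obtain ⟨z, hz, hyz, hle⟩ := exists_mem_eq_lastPoint hT h0 hH hx y
    rw [lastPoint_eq_self hT h0 hx, hyz]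
    exact h hz (hle.trans_lt hy)
  have hgap : ∀ x, 0 < x → x ∉ T → HasDerivAt (fun y => H (lastPoint T y)) 0 x := by
    intro x hx0 hx
    refine (hasDerivAt_const x (H (lastPoint T x))).congr_of_eventuallyEq ?_
    filter_upwards [lastPoint_eventuallyEq hT h0 hx0 hx] with y hy
    rw [hy]
  have hdense : ∀ x ∈ T, x ∈ D → ¬ RightScattered T x →
      HasDerivAt (fun y => H (lastPoint T y)) 0 x := by
    intro x hx hxD hxs
    have hσ : forwardJump T x = x := le_antisymm (not_lt.1 hxs) (le_forwardJump hx)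
    rw [hasDerivAt_iff_isLittleO, Asymptotics.isLittleO_iff]
    intro ε hε
    obtain ⟨δ, hδ, h⟩ := (hd x hxD).le_mul hε
    filter_upwards [Metric.ball_mem_nhds x hδ] with y hy
    obtain ⟨z, hz, hyz, hle⟩ := exists_mem_eq_lastPoint hT h0 hH hx y
    have hzy : |z - x| < δ := hle.trans_lt hy
    have hz' := h z ⟨⟨by linarith [(abs_lt.1 hzy).1], by linarith [(abs_lt.1 hzy).2]⟩, hz⟩
    rw [hσ, zero_mul, sub_zero, abs_sub_comm, abs_sub_comm x] at hz'
    rw [lastPoint_eq_self hT h0 hx, hyz, smul_zero, sub_zero]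
    exact hz'.trans (mul_le_mul_of_nonneg_left hle hε.le)
  have hcount : ((kappa T \ D) ∪ {t ∈ T | RightScattered T t} ∪ (T \ kappa T)).Countable :=
    (hD.union countable_rightScattered).union diff_kappa_subsingleton.countable
  have hint := integral_eq_of_hasDerivAt_off_countable (fun y => H (lastPoint T y)) (fun _ => 0)
    (a := a) (b := b) hcount (fun x hx => ?_) (fun x hx => ?_) intervalIntegrable_const
  · simp only [intervalIntegral.integral_zero, lastPoint_eq_self hT h0 ha,
      lastPoint_eq_self hT h0 hb] at hint
    linarith
  · refine ContinuousAt.continuousWithinAt ?_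
    by_cases hxT : x ∈ T
    · exact hcont x hxT
    · have hx0 : 0 ≤ x := (le_min (h0.2 ha) (h0.2 hb)).trans hx.1
      have : x ≠ 0 := fun h => hxT (h ▸ h0.1)
      exact (hgap x (lt_of_le_of_ne hx0 this.symm) hxT).continuousAt
  · have hx0 : 0 < x := (le_min (h0.2 ha) (h0.2 hb)).trans_lt hx.1.1
    by_cases hxT : x ∈ T
    · have hk : x ∈ kappa T := by
        by_contra hk
        exact hx.2 (Or.inr ⟨hxT, hk⟩)
      refine hdense x hxT ?_ fun hs => hx.2 (Or.inl (Or.inr ⟨hxT, hs⟩))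
      by_contra hxD
      exact hx.2 (Or.inl (Or.inl ⟨hk, hxD⟩))
    · exact hgap x hx0 hxT

theorem isPreAntiderivative_integral (hT : IsClosed T) (h0 : IsLeast T 0)
    (hf : ContinuousOn f T) :
    IsPreAntiderivative T f fun t => ∫ x in (0 : ℝ)..t, f (lastPoint T x) :=
  ⟨(continuous_integral_lastPoint (intervalIntegrable_comp_lastPoint hT h0 hf)).continuousOn,
    kappa T, subset_rfl, by simp, by simp,
    fun _ ht => hasDeltaDerivAt_integral hT h0 hf (kappa_subset ht)⟩

theorem IsPreAntiderivative.sub_eq_integral (hT : IsClosed T) (h0 : IsLeast T 0)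
    (hf : ContinuousOn f T) (hF : IsPreAntiderivative T f F) (ha : a ∈ T) (hb : b ∈ T) :
    F b - F a = ∫ x in a..b, f (lastPoint T x) := by
  have hi := intervalIntegrable_comp_lastPoint hT h0 hf
  obtain ⟨hc, D, hDk, hDc, hDs, hDd⟩ := hF
  have h := eq_of_hasDeltaDerivAt_zero hT h0
    (H := fun t => F t - ∫ x in (0 : ℝ)..t, f (lastPoint T x))
    (hc.sub (continuous_integral_lastPoint hi).continuousOn) hDc hDs
    (fun t ht => by
      simpa using (hDd t ht).sub (hasDeltaDerivAt_integral hT h0 hf (kappa_subset (hDk ht)))) ha hb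
  rw [← intervalIntegral.integral_interval_sub_left (hi 0 b) (hi 0 a)]
  linarith

theorem deltaIntegral_eq_integral (hT : IsClosed T) (h0 : IsLeast T 0) (hf : ContinuousOn f T)
    (ha : a ∈ T) (hb : b ∈ T) :
    deltaIntegral T f a b = ∫ x in a..b, f (lastPoint T x) := by
  have hreg : Regulated T f :=
    ⟨fun t ht _ => ⟨f t, (hf t ht).mono inter_subset_left⟩,
      fun t ht _ => ⟨f t, (hf t ht).mono inter_subset_left⟩⟩
  have h : Regulated T f ∧ ∃ F : ℝ → ℝ, IsPreAntiderivative T f F :=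
    ⟨hreg, _, isPreAntiderivative_integral hT h0 hf⟩
  rw [deltaIntegral, dif_pos h]
  exact (Classical.choose_spec h.2).sub_eq_integral hT h0 hf ha hb

/-! ### The exponential function -/

/-- The cylinder transformation `log (1 + μ c) / μ`, with value `c` where the graininess `μ`
vanishes; `e_c(t, 0)` is the exponential of its integral. -/
noncomputable def cylinder (T : Set ℝ) (c : ℝ → ℝ) (t : ℝ) : ℝ :=
  if graininess T t = 0 then c t else Real.log (1 + graininess T t * c t) / graininess T t


theorem graininess_nonneg (ht : t ∈ T) : 0 ≤ graininess T t := sub_nonneg.2 (le_forwardJump ht)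

theorem cylinder_le (ht : t ∈ T) (hc : 0 ≤ c t) : cylinder T c t ≤ c t := by
  unfold cylinder
  have hμ := graininess_nonneg ht
  split_ifs with h
  · exact le_rfl
  · have hμ' := lt_of_le_of_ne hμ (Ne.symm h)
    rw [div_le_iff₀ hμ']
    have := Real.log_le_sub_one_of_pos (x := 1 + graininess T t * c t) (by positivity)
    linarith

theorem div_le_cylinder (ht : t ∈ T) (hc : 0 ≤ c t) :
    c t / (1 + graininess T t * c t) ≤ cylinder T c t := by
  unfold cylinder
  have hμ := graininess_nonneg ht
  split_ifs with h
  · simp [h]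
  · have hμ' := lt_of_le_of_ne hμ (Ne.symm h)
    have hpos : 0 < 1 + graininess T t * c t := by positivity
    rw [le_div_iff₀ hμ']
    have := Real.one_sub_inv_le_log_of_pos hpos
    refine le_trans (le_of_eq ?_) this
    field_simp
    ring

theorem cylinder_nonneg (ht : t ∈ T) (hc : 0 ≤ c t) : 0 ≤ cylinder T c t :=
  (div_nonneg hc (by have := graininess_nonneg ht; positivity)).trans (div_le_cylinder ht hc)

theorem exp_cylinder_mul (hμ : 0 < graininess T t) (hc : 0 ≤ c t) :
    Real.exp (cylinder T c t * graininess T t) = 1 + graininess T t * c t := by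
  rw [cylinder, if_neg hμ.ne', div_mul_cancel₀ _ hμ.ne', Real.exp_log (by positivity)]

theorem measurable_cylinder_comp_lastPoint (hT : IsClosed T) (h0 : IsLeast T 0)
    (hc : ContinuousOn c T) : Measurable fun x => cylinder T c (lastPoint T x) := by
  have hl : Measurable (lastPoint T) := (lastPoint_mono h0).measurable
  have hμ : Measurable fun x => graininess T (lastPoint T x) :=
    (forwardJump_mono.measurable.comp hl).sub hl
  have hc' := measurable_comp_lastPoint hT h0 hc
  exact Measurable.ite (hμ (measurableSet_singleton 0)) hc'
    ((Real.measurable_log.comp ((hμ.mul hc').const_add 1)).div hμ)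

/-- The graininess is continuous at points that are not right-scattered. -/
theorem tendsto_graininess (hσ : forwardJump T t = t) :
    Tendsto (graininess T) (𝓝[T] t) (𝓝 0) := by
  rw [Metric.tendsto_nhds]
  intro ε hε
  obtain ⟨r, hr, hev⟩ : ∃ r < t + ε / 2, ∀ᶠ s in 𝓝[T] t, forwardJump T s ≤ r := by
    by_cases hmax : ∃ s ∈ T, t < s
    · have hlt : sInf {s ∈ T | t < s} < t + ε / 2 := by
        have h1 := hσ
        rw [forwardJump, if_pos (show ({s ∈ T | t < s}).Nonempty from hmax)] at h1
        linarith
      obtain ⟨r, hr, hrlt⟩ := exists_lt_of_csInf_lt hmax hlt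
      refine ⟨r, hrlt, ?_⟩
      filter_upwards [mem_nhdsWithin_of_mem_nhds (Iio_mem_nhds hr.2)] with s hs
      exact forwardJump_le hr.1 hs
    · push Not at hmax
      refine ⟨t, by linarith, ?_⟩
      filter_upwards [self_mem_nhdsWithin] with s hs
      exact (forwardJump_mono (hmax s hs)).trans_eq hσ
  filter_upwards [self_mem_nhdsWithin, hev,
    mem_nhdsWithin_of_mem_nhds (Ioi_mem_nhds (by linarith : t - ε / 2 < t))] with s hs hsr hst
  rw [Real.dist_eq, sub_zero, abs_of_nonneg (graininess_nonneg hs)]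
  have : t - ε / 2 < s := hst
  unfold graininess
  linarith

theorem continuousWithinAt_cylinder (hc : ContinuousOn c T) (hc0 : ∀ s ∈ T, 0 ≤ c s)
    (ht : t ∈ T) (hσ : forwardJump T t = t) : ContinuousWithinAt (cylinder T c) T t := by
  have hval : cylinder T c t = c t := by simp [cylinder, graininess, hσ]
  rw [ContinuousWithinAt, hval]
  have hlow : Tendsto (fun s => c s / (1 + graininess T s * c s)) (𝓝[T] t) (𝓝 (c t)) := by
    have := (hc t ht).tendsto.div
      (((tendsto_graininess hσ).mul (hc t ht).tendsto).const_add 1) (by simp)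
    simpa only [zero_mul, add_zero, div_one, Pi.div_def] using this
  refine tendsto_of_tendsto_of_tendsto_of_le_of_le' hlow (hc t ht) ?_ ?_
  · filter_upwards [self_mem_nhdsWithin] with s hs using div_le_cylinder hs (hc0 s hs)
  · filter_upwards [self_mem_nhdsWithin] with s hs using cylinder_le hs (hc0 s hs)

theorem isExpSolution_exp_integral (hT : IsClosed T) (h0 : IsLeast T 0) (hc : ContinuousOn c T)
    (hc0 : ∀ s ∈ T, 0 ≤ c s) :
    IsExpSolution T c 0 fun t => Real.exp (∫ x in (0 : ℝ)..t, cylinder T c (lastPoint T x)) := by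
  have hi := intervalIntegrable_of_abs_le hT h0 (measurable_cylinder_comp_lastPoint hT h0 hc) hc
    fun s hs => by
      rw [abs_of_nonneg (cylinder_nonneg hs (hc0 s hs))]
      exact cylinder_le hs (hc0 s hs)
  refine ⟨by simp, fun t htk => ?_⟩
  have ht := kappa_subset htk
  rcases (le_forwardJump ht).eq_or_lt with h | h
  · have hval : cylinder T c t = c t := by simp [cylinder, graininess, ← h]
    have hd := (hasDerivWithinAt_integral_lastPoint hT h0 hi ht
      (continuousWithinAt_cylinder hc hc0 ht h.symm)).exp
    rw [hval, mul_comm] at hd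
    exact hasDeltaDerivAt_of_hasDerivWithinAt h.symm hd
  · refine hasDeltaDerivAt_of_rightScattered h
      (continuous_integral_lastPoint hi).rexp.continuousWithinAt ?_
    rw [← intervalIntegral.integral_add_adjacent_intervals (hi 0 t) (hi t _), Real.exp_add,
      integral_forwardJump hT h0 ht]
    have := exp_cylinder_mul (sub_pos.2 h : 0 < graininess T t) (hc0 t ht)
    unfold graininess at this
    rw [this]
    ring

theorem IsExpSolution.continuousOn {x : ℝ → ℝ} (hx : IsExpSolution T c 0 x) :
    ContinuousOn x T := fun t ht => by
  by_cases hk : t ∈ kappa T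
  · exact (hx.2 t hk).continuousWithinAt ht
  · exact continuousWithinAt_of_mem_diff_kappa ⟨ht, hk⟩

theorem IsExpSolution.eq_integral {x : ℝ → ℝ} (hT : IsClosed T) (h0 : IsLeast T 0)
    (hc : ContinuousOn c T) (hx : IsExpSolution T c 0 x) (ht : t ∈ T) :
    x t = 1 + ∫ s in (0 : ℝ)..t, c (lastPoint T s) * x (lastPoint T s) := by
  have hpre : IsPreAntiderivative T (fun s => c s * x s) x :=
    ⟨hx.continuousOn, kappa T, subset_rfl, by simp, by simp, hx.2⟩
  have h := hpre.sub_eq_integral hT h0 (hc.mul hx.continuousOn) h0.1 ht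
  rw [hx.1] at h
  exact eq_add_of_sub_eq' h

theorem isExpSolution_deltaExp (hT : IsClosed T) (h0 : IsLeast T 0) (hc : ContinuousOn c T)
    (hc0 : ∀ s ∈ T, 0 ≤ c s) : IsExpSolution T c 0 fun t => deltaExp T c t 0 := by
  have hrd : RdContinuous T c :=
    ⟨fun t ht _ => hc t ht, fun t ht _ => ⟨c t, (hc t ht).mono inter_subset_left⟩⟩
  have hreg : Regressive T c := fun t ht => by
    have := mul_nonneg (graininess_nonneg ht) (hc0 t ht)
    positivity
  have h : RdContinuous T c ∧ Regressive T c ∧ ∃ x : ℝ → ℝ, IsExpSolution T c 0 x :=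
    ⟨hrd, hreg, _, isExpSolution_exp_integral hT h0 hc hc0⟩
  have heq : (fun t => deltaExp T c t 0) = Classical.choose h.2.2 := by
    funext t
    rw [deltaExp, dif_pos h]
  rw [heq]
  exact Classical.choose_spec h.2.2

/-! ### Grönwall inequalities -/

/-- Integral form of Grönwall's inequality for a bounded function. Under the weight
`exp (K x)` with `K > 2 C`, each use of the hypothesis halves the bound. -/
theorem nonpos_of_le_mul_integral {C M : ℝ} (hC : 0 ≤ C)
    (hi : ∀ x, IntervalIntegrable f volume 0 x) (hM : ∀ x ∈ Icc 0 b, f x ≤ M)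
    (h : ∀ x ∈ Icc 0 b, f x ≤ C * ∫ y in (0 : ℝ)..x, f y) {x : ℝ} (hx : x ∈ Icc 0 b) :
    f x ≤ 0 := by
  set K := 2 * C + 1
  have hK : 0 < K := by positivity
  have key : ∀ n : ℕ, ∀ y ∈ Icc 0 b, f y ≤ |M| * (1 / 2) ^ n * Real.exp (K * y) := by
    intro n
    induction n with
    | zero =>
      intro y hy
      have h1 : 1 ≤ Real.exp (K * y) := Real.one_le_exp (mul_nonneg hK.le hy.1)
      have h2 := (hM y hy).trans (le_abs_self M)
      rw [pow_zero, mul_one]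
      exact h2.trans (le_mul_of_one_le_right (abs_nonneg M) h1)
    | succ n ih =>
      intro y hy
      set N := |M| * (1 / 2) ^ n
      have hN : 0 ≤ N := by positivity
      have hint : ∫ z in (0 : ℝ)..y, f z ≤ ∫ z in (0 : ℝ)..y, N * Real.exp (K * z) :=
        intervalIntegral.integral_mono_on hy.1 (hi y)
          (Continuous.intervalIntegrable (by fun_prop) _ _)
          fun z hz => ih z ⟨hz.1, hz.2.trans hy.2⟩
      have hval : ∫ z in (0 : ℝ)..y, N * Real.exp (K * z) = N * (Real.exp (K * y) - 1) / K := by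
        rw [intervalIntegral.integral_const_mul, intervalIntegral.integral_comp_mul_left _ hK.ne',
          integral_exp]
        simp
        ring
      rw [hval] at hint
      have he : 0 < Real.exp (K * y) := Real.exp_pos _
      calc f y ≤ C * (N * (Real.exp (K * y) - 1) / K) :=
            (h y hy).trans (mul_le_mul_of_nonneg_left hint hC)
        _ ≤ C * (N * Real.exp (K * y) / K) := by gcongr; linarith
        _ = C / K * (N * Real.exp (K * y)) := by ring
        _ ≤ 1 / 2 * (N * Real.exp (K * y)) := by
            refine mul_le_mul_of_nonneg_right ?_ (by positivity)
            rw [div_le_div_iff₀ hK two_pos]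
            linarith
        _ = |M| * (1 / 2) ^ (n + 1) * Real.exp (K * y) := by rw [pow_succ]; ring
  have hlim : Tendsto (fun n : ℕ => |M| * (1 / 2 : ℝ) ^ n * Real.exp (K * x)) atTop (𝓝 0) := by
    have := ((tendsto_pow_atTop_nhds_zero_of_lt_one (by norm_num : (0 : ℝ) ≤ 1 / 2)
      (by norm_num)).const_mul |M|).mul_const (Real.exp (K * x))
    simpa using this
  exact ge_of_tendsto' hlim fun n => key n x hx

variable {U α e : ℝ → ℝ}

/-- Grönwall's inequality on a time scale: with `z` and `A` the integrals of `U` and `α` from `0`,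
and `e` the exponential function of `c`, the inequality `z^Δ ≤ α + c z` gives `z ≤ A e`. -/
theorem integral_le_integral_mul_exp (hT : IsClosed T) (h0 : IsLeast T 0)
    (hU : ContinuousOn U T) (hα : ContinuousOn α T) (hc : ContinuousOn c T)
    (he : ContinuousOn e T) (hα0 : ∀ s ∈ T, 0 ≤ α s) (hc0 : ∀ s ∈ T, 0 ≤ c s)
    (hle : ∀ s ∈ T, U s ≤ α s + c s * ∫ x in (0 : ℝ)..s, U (lastPoint T x))
    (hexp : ∀ s ∈ T, e s = 1 + ∫ x in (0 : ℝ)..s, c (lastPoint T x) * e (lastPoint T x))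
    (ht : t ∈ T) :
    ∫ x in (0 : ℝ)..t, U (lastPoint T x) ≤ (∫ x in (0 : ℝ)..t, α (lastPoint T x)) * e t := by
  set A := ∫ x in (0 : ℝ)..t, α (lastPoint T x) with hA
  have hiU := intervalIntegrable_comp_lastPoint hT h0 hU
  have hiα := intervalIntegrable_comp_lastPoint hT h0 hα
  have hz : ContinuousOn (fun s => ∫ x in (0 : ℝ)..s, U (lastPoint T x)) T :=
    (continuous_integral_lastPoint hiU).continuousOn
  -- As `α ≥ 0`, it suffices to compare `z` with the multiple `A e` of `e`, where `A` is frozen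
  -- at its value at `t`; the difference `d` satisfies a homogeneous integral inequality.
  set d : ℝ → ℝ := fun s => (∫ x in (0 : ℝ)..s, U (lastPoint T x)) - A * e s with hd
  have hdc : ContinuousOn d T := hz.sub (continuousOn_const.mul he)
  have hid : ∀ a b, IntervalIntegrable
      (fun x => c (lastPoint T x) * d (lastPoint T x)) volume a b :=
    intervalIntegrable_comp_lastPoint hT h0 (hc.mul hdc)
  have hice : ∀ a b, IntervalIntegrable
      (fun x => c (lastPoint T x) * e (lastPoint T x)) volume a b :=
    intervalIntegrable_comp_lastPoint hT h0 (hc.mul he)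
  have hd_le : ∀ s ∈ T, s ≤ t → d s ≤ ∫ x in (0 : ℝ)..s, c (lastPoint T x) * d (lastPoint T x) := by
    intro s hs hst
    have hs0 : 0 ≤ s := h0.2 hs
    have h1 : ∫ x in (0 : ℝ)..s, U (lastPoint T x) ≤
        ∫ x in (0 : ℝ)..s, (α (lastPoint T x) + (c (lastPoint T x) * d (lastPoint T x)
          + A * (c (lastPoint T x) * e (lastPoint T x)))) := by
      refine intervalIntegral.integral_mono_on hs0 (hiU 0 s)
        ((hiα 0 s).add ((hid 0 s).add ((hice 0 s).const_mul A))) fun x _ => ?_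
      refine (hle _ (lastPoint_mem hT h0 x)).trans (le_of_eq ?_)
      simp only [hd]
      ring
    have h2 : ∫ x in (0 : ℝ)..s, α (lastPoint T x) ≤ A := by
      rw [hA, ← intervalIntegral.integral_add_adjacent_intervals (hiα 0 s) (hiα s t)]
      exact le_add_of_nonneg_right (intervalIntegral.integral_nonneg hst
        fun x _ => hα0 _ (lastPoint_mem hT h0 x))
    rw [intervalIntegral.integral_add (hiα 0 s) ((hid 0 s).add ((hice 0 s).const_mul A)),
      intervalIntegral.integral_add (hid 0 s) ((hice 0 s).const_mul A),
      intervalIntegral.integral_const_mul] at h1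
    have h3 : d s = (∫ x in (0 : ℝ)..s, U (lastPoint T x))
        - A * (1 + ∫ x in (0 : ℝ)..s, c (lastPoint T x) * e (lastPoint T x)) := by
      rw [← hexp s hs]
    rw [h3]
    linarith
  have hcomp : IsCompact (T ∩ Icc 0 t) := isCompact_Icc.inter_left hT
  obtain ⟨C, hC⟩ := hcomp.exists_bound_of_continuousOn (hc.mono inter_subset_left)
  obtain ⟨M, hM⟩ := hcomp.exists_bound_of_continuousOn (hdc.mono inter_subset_left)
  have hmem : ∀ x ∈ Icc 0 t, lastPoint T x ∈ T ∩ Icc 0 t := fun x hx =>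
    ⟨lastPoint_mem hT h0 x, lastPoint_nonneg hT h0 x, (lastPoint_le hT h0 hx.1).trans hx.2⟩
  have hC0 : 0 ≤ C := (norm_nonneg _).trans (hC 0 ⟨h0.1, le_rfl, h0.2 ht⟩)
  have hdp : ContinuousOn (fun s => max (d s) 0) T := hdc.sup continuousOn_const
  have hip := intervalIntegrable_comp_lastPoint hT h0 hdp
  have hfin := nonpos_of_le_mul_integral (f := fun x => max (d (lastPoint T x)) 0) (b := t)
    (M := M) hC0 (hip 0) (fun x hx => ?_) (fun x hx => ?_) (right_mem_Icc.2 (h0.2 ht))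
  · simp only [lastPoint_eq_self hT h0 ht] at hfin
    have := (le_max_left _ _).trans hfin
    simp only [hd] at this
    linarith
  · have h1 := hM _ (hmem x hx)
    exact max_le ((le_abs_self _).trans h1) ((norm_nonneg _).trans h1)
  · have hy := hmem x hx
    have hyx := lastPoint_le hT h0 hx.1
    have hnn : ∀ a b, a ≤ b → 0 ≤ ∫ y in a..b, max (d (lastPoint T y)) 0 := fun a b hab =>
      intervalIntegral.integral_nonneg hab fun y _ => le_max_right _ _
    refine max_le ?_ (mul_nonneg hC0 (hnn _ _ hx.1))
    calc d (lastPoint T x)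
        ≤ ∫ y in (0 : ℝ)..lastPoint T x, c (lastPoint T y) * d (lastPoint T y) :=
          hd_le _ hy.1 hy.2.2
      _ ≤ ∫ y in (0 : ℝ)..lastPoint T x, C * max (d (lastPoint T y)) 0 := by
          refine intervalIntegral.integral_mono_on hy.2.1 (hid _ _) ((hip _ _).const_mul C)
            fun z hz => ?_
          have hz' := hmem z ⟨hz.1, hz.2.trans hy.2.2⟩
          exact (mul_le_mul_of_nonneg_left (le_max_left _ 0) (hc0 _ hz'.1)).trans
            (mul_le_mul_of_nonneg_right ((le_abs_self _).trans (hC _ hz')) (le_max_right _ _))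
      _ = C * ∫ y in (0 : ℝ)..lastPoint T x, max (d (lastPoint T y)) 0 :=
          intervalIntegral.integral_const_mul _ _
      _ ≤ C * ∫ y in (0 : ℝ)..x, max (d (lastPoint T y)) 0 := by
          refine mul_le_mul_of_nonneg_left ?_ hC0
          rw [← intervalIntegral.integral_add_adjacent_intervals (hip 0 (lastPoint T x)) (hip _ x)]
          exact le_add_of_nonneg_right (hnn _ _ hyx)

/-! ### Functions of two variables -/

variable {T₁ T₂ : Set ℝ} {k : ℝ → ℝ → ℝ} {τ : ℝ}

theorem continuousOn_integral_lastPoint (hT₁ : IsClosed T₁) (hT₂ : IsClosed T₂)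
    (h0₂ : IsLeast T₂ 0) (hk : ContinuousOn (Function.uncurry k) (T₁ ×ˢ T₂)) (hτ : 0 ≤ τ) :
    ContinuousOn (fun s₁ => ∫ y in (0 : ℝ)..τ, k s₁ (lastPoint T₂ y)) T₁ := by
  intro s hs
  have hsec : ∀ s₁ ∈ T₁, ContinuousOn (k s₁) T₂ := fun s₁ h₁ =>
    hk.uncurry_left (f := k) s₁ h₁
  have hcomp : IsCompact ((T₁ ∩ Metric.closedBall s 1) ×ˢ (T₂ ∩ Icc 0 τ)) :=
    ((isCompact_closedBall s 1).inter_left hT₁).prod (isCompact_Icc.inter_left hT₂)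
  obtain ⟨C, hC⟩ := hcomp.exists_bound_of_continuousOn
    (hk.mono (prod_mono inter_subset_left inter_subset_left))
  refine intervalIntegral.continuousWithinAt_of_dominated_interval (bound := fun _ => C)
    ?_ ?_ intervalIntegrable_const ?_
  · filter_upwards [self_mem_nhdsWithin] with s₁ h₁
    exact (measurable_comp_lastPoint hT₂ h0₂ (hsec s₁ h₁)).aestronglyMeasurable
  · filter_upwards [self_mem_nhdsWithin,
      mem_nhdsWithin_of_mem_nhds (Metric.closedBall_mem_nhds s one_pos)] with s₁ h₁ hb
    refine Eventually.of_forall fun y hy => ?_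
    rw [uIoc_of_le hτ] at hy
    exact hC (s₁, lastPoint T₂ y) ⟨⟨h₁, hb⟩, lastPoint_mem hT₂ h0₂ y,
      lastPoint_nonneg hT₂ h0₂ y, (lastPoint_le hT₂ h0₂ hy.1.le).trans hy.2⟩
  · refine Eventually.of_forall fun y _ => ?_
    exact hk.uncurry_right (f := k) _ (lastPoint_mem hT₂ h0₂ y) s hs

theorem deltaIntegral_deltaIntegral_eq (hT₁ : IsClosed T₁) (hT₂ : IsClosed T₂)
    (h0₁ : IsLeast T₁ 0) (h0₂ : IsLeast T₂ 0)
    (hk : ContinuousOn (Function.uncurry k) (T₁ ×ˢ T₂)) {t₁ t₂ : ℝ} (ht₁ : t₁ ∈ T₁)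
    (ht₂ : t₂ ∈ T₂) :
    deltaIntegral T₁ (fun s₁ => deltaIntegral T₂ (fun s₂ => k s₁ s₂) 0 t₂) 0 t₁ =
      ∫ x in (0 : ℝ)..t₁, ∫ y in (0 : ℝ)..t₂, k (lastPoint T₁ x) (lastPoint T₂ y) := by
  have heq : ∀ s₁ ∈ T₁, deltaIntegral T₂ (fun s₂ => k s₁ s₂) 0 t₂ =
      ∫ y in (0 : ℝ)..t₂, k s₁ (lastPoint T₂ y) := fun s₁ h₁ =>
    deltaIntegral_eq_integral hT₂ h0₂ (hk.uncurry_left (f := k) s₁ h₁) h0₂.1 ht₂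
  have hcont := (continuousOn_integral_lastPoint hT₁ hT₂ h0₂ hk (h0₂.2 ht₂)).congr heq
  rw [deltaIntegral_eq_integral hT₁ h0₁ hcont h0₁.1 ht₁]
  exact intervalIntegral.integral_congr fun x _ => heq _ (lastPoint_mem hT₁ h0₁ x)

theorem isClosed_nonnegPart (hT : IsClosed T) : IsClosed (nonnegPart T) := isClosed_Ici.inter hT

theorem isLeast_nonnegPart (h0 : (0 : ℝ) ∈ T) : IsLeast (nonnegPart T) 0 :=
  ⟨⟨self_mem_Ici, h0⟩, fun _ hs => hs.1⟩

end TimeScale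

theorem corollary6p5 (T₁ T₂ : Set ℝ)
    (hT₁ : TimeScale.IsTimeScale T₁) (hT₂ : TimeScale.IsTimeScale T₂)
    (h0₁ : (0 : ℝ) ∈ T₁) (h0₂ : (0 : ℝ) ∈ T₂)
    (hpos₁ : ∃ t ∈ T₁, 0 < t) (hpos₂ : ∃ t ∈ T₂, 0 < t)
    (u p q k : ℝ → ℝ → ℝ)
    (hu : ContinuousOn (Function.uncurry u)
      (TimeScale.nonnegPart T₁ ×ˢ TimeScale.nonnegPart T₂))
    (hp : ContinuousOn (Function.uncurry p)
      (TimeScale.nonnegPart T₁ ×ˢ TimeScale.nonnegPart T₂))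
    (hq : ContinuousOn (Function.uncurry q)
      (TimeScale.nonnegPart T₁ ×ˢ TimeScale.nonnegPart T₂))
    (hk : ContinuousOn (Function.uncurry k)
      (TimeScale.nonnegPart T₁ ×ˢ TimeScale.nonnegPart T₂))
    (hu0 : ∀ t₁ ∈ TimeScale.nonnegPart T₁, ∀ t₂ ∈ TimeScale.nonnegPart T₂, 0 ≤ u t₁ t₂)
    (hp0 : ∀ t₁ ∈ TimeScale.nonnegPart T₁, ∀ t₂ ∈ TimeScale.nonnegPart T₂, 0 ≤ p t₁ t₂)
    (hq0 : ∀ t₁ ∈ TimeScale.nonnegPart T₁, ∀ t₂ ∈ TimeScale.nonnegPart T₂, 0 ≤ q t₁ t₂)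
    (hk0 : ∀ t₁ ∈ TimeScale.nonnegPart T₁, ∀ t₂ ∈ TimeScale.nonnegPart T₂, 0 ≤ k t₁ t₂)
    (h : ∀ t₁ ∈ TimeScale.nonnegPart T₁, ∀ t₂ ∈ TimeScale.nonnegPart T₂,
      u t₁ t₂ ≤ p t₁ t₂ + q t₁ t₂ *
        TimeScale.deltaIntegral (TimeScale.nonnegPart T₁) (fun s₁ =>
          TimeScale.deltaIntegral (TimeScale.nonnegPart T₂) (fun s₂ =>
            k s₁ s₂ * u s₁ s₂) 0 t₂) 0 t₁) :
    ∀ t₁ ∈ TimeScale.nonnegPart T₁, ∀ t₂ ∈ TimeScale.nonnegPart T₂,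
      u t₁ t₂ ≤ p t₁ t₂ + q t₁ t₂ *
        -- `A(t₁, t₂)`
        TimeScale.deltaIntegral (TimeScale.nonnegPart T₁) (fun s₁ =>
          TimeScale.deltaIntegral (TimeScale.nonnegPart T₂) (fun s₂ =>
            k s₁ s₂ * p s₁ s₂) 0 t₂) 0 t₁ *
        -- `e_c(t₁, 0)`, the exponential of `s₁ ↦ c(s₁, t₂)`
        TimeScale.deltaExp (TimeScale.nonnegPart T₁) (fun s₁ =>
          TimeScale.deltaIntegral (TimeScale.nonnegPart T₂) (fun s₂ =>
            k s₁ s₂ * q s₁ s₂) 0 t₂) t₁ 0 := by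
  have hc₁ := TimeScale.isClosed_nonnegPart hT₁.1
  have hc₂ := TimeScale.isClosed_nonnegPart hT₂.1
  have hl₁ := TimeScale.isLeast_nonnegPart h0₁
  have hl₂ := TimeScale.isLeast_nonnegPart h0₂
  generalize TimeScale.nonnegPart T₁ = S₁ at *
  generalize TimeScale.nonnegPart T₂ = S₂ at *
  intro t₁ ht₁ τ hτ
  have hτ0 : 0 ≤ τ := hl₂.2 hτ
  have hku : ContinuousOn (Function.uncurry fun s₁ s₂ => k s₁ s₂ * u s₁ s₂) (S₁ ×ˢ S₂) :=
    hk.mul hu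
  have hkp : ContinuousOn (Function.uncurry fun s₁ s₂ => k s₁ s₂ * p s₁ s₂) (S₁ ×ˢ S₂) :=
    hk.mul hp
  have hkq : ContinuousOn (Function.uncurry fun s₁ s₂ => k s₁ s₂ * q s₁ s₂) (S₁ ×ˢ S₂) :=
    hk.mul hq
  have hm₁ := TimeScale.lastPoint_mem hc₁ hl₁
  have hm₂ := TimeScale.lastPoint_mem hc₂ hl₂
  have hsec : ∀ {g : ℝ → ℝ → ℝ}, ContinuousOn (Function.uncurry g) (S₁ ×ˢ S₂) → ∀ s₁ ∈ S₁,
      ∀ a b, IntervalIntegrable (fun y => g s₁ (TimeScale.lastPoint S₂ y)) MeasureTheory.volume a b :=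
    fun {g} hg s₁ h₁ =>
      TimeScale.intervalIntegrable_comp_lastPoint hc₂ hl₂ (hg.uncurry_left (f := g) s₁ h₁)
  have hcU := TimeScale.continuousOn_integral_lastPoint hc₁ hc₂ hl₂ hku hτ0
  have hcα := TimeScale.continuousOn_integral_lastPoint hc₁ hc₂ hl₂ hkp hτ0
  have hcc : ContinuousOn (fun s₁ => TimeScale.deltaIntegral S₂ (fun s₂ =>
      k s₁ s₂ * q s₁ s₂) 0 τ) S₁ :=
    (TimeScale.continuousOn_integral_lastPoint hc₁ hc₂ hl₂ hkq hτ0).congr fun s₁ h₁ =>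
      TimeScale.deltaIntegral_eq_integral hc₂ hl₂
        (hkq.uncurry_left (f := fun s₁ s₂ => k s₁ s₂ * q s₁ s₂) s₁ h₁) hl₂.1 hτ
  have hcval : ∀ s₁ ∈ S₁, TimeScale.deltaIntegral S₂ (fun s₂ => k s₁ s₂ * q s₁ s₂) 0 τ =
      ∫ y in (0 : ℝ)..τ, k s₁ (TimeScale.lastPoint S₂ y) * q s₁ (TimeScale.lastPoint S₂ y) :=
    fun s₁ h₁ => TimeScale.deltaIntegral_eq_integral hc₂ hl₂
      (hkq.uncurry_left (f := fun s₁ s₂ => k s₁ s₂ * q s₁ s₂) s₁ h₁) hl₂.1 hτ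
  have hcn : ∀ s₁ ∈ S₁, 0 ≤ TimeScale.deltaIntegral S₂ (fun s₂ => k s₁ s₂ * q s₁ s₂) 0 τ := by
    intro s₁ h₁
    rw [hcval s₁ h₁]
    exact intervalIntegral.integral_nonneg hτ0 fun y _ =>
      mul_nonneg (hk0 _ h₁ _ (hm₂ y)) (hq0 _ h₁ _ (hm₂ y))
  have hsol := TimeScale.isExpSolution_deltaExp hc₁ hl₁ hcc hcn
  refine (h t₁ ht₁ τ hτ).trans ?_
  rw [add_le_add_iff_left, mul_assoc]
  refine mul_le_mul_of_nonneg_left ?_ (hq0 t₁ ht₁ τ hτ)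
  rw [TimeScale.deltaIntegral_deltaIntegral_eq hc₁ hc₂ hl₁ hl₂ hku ht₁ hτ,
    TimeScale.deltaIntegral_deltaIntegral_eq hc₁ hc₂ hl₁ hl₂ hkp ht₁ hτ]
  refine TimeScale.integral_le_integral_mul_exp hc₁ hl₁ hcU hcα hcc hsol.continuousOn ?_ hcn ?_
    (fun s hs => hsol.eq_integral hc₁ hl₁ hcc hs) ht₁
  · exact fun s₁ h₁ => intervalIntegral.integral_nonneg hτ0 fun y _ =>
      mul_nonneg (hk0 _ h₁ _ (hm₂ y)) (hp0 _ h₁ _ (hm₂ y))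
  · intro s₁ h₁
    rw [hcval s₁ h₁, ← intervalIntegral.integral_mul_const,
      ← intervalIntegral.integral_add (hsec hkp s₁ h₁ 0 τ)
        ((hsec hkq s₁ h₁ 0 τ).mul_const _)]
    refine intervalIntegral.integral_mono_on hτ0 (hsec hku s₁ h₁ 0 τ)
      ((hsec hkp s₁ h₁ 0 τ).add ((hsec hkq s₁ h₁ 0 τ).mul_const _)) fun y hy => ?_
    have hyle : TimeScale.lastPoint S₂ y ≤ τ := (TimeScale.lastPoint_le hc₂ hl₂ hy.1).trans hy.2
    have hy0 := TimeScale.lastPoint_nonneg hc₂ hl₂ y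
    -- The double integral of `k u` is monotone in its second upper limit.
    have hmono : (∫ x in (0 : ℝ)..s₁, ∫ z in (0 : ℝ)..TimeScale.lastPoint S₂ y,
          k (TimeScale.lastPoint S₁ x) (TimeScale.lastPoint S₂ z) *
            u (TimeScale.lastPoint S₁ x) (TimeScale.lastPoint S₂ z)) ≤
        ∫ x in (0 : ℝ)..s₁, ∫ z in (0 : ℝ)..τ,
          k (TimeScale.lastPoint S₁ x) (TimeScale.lastPoint S₂ z) *
            u (TimeScale.lastPoint S₁ x) (TimeScale.lastPoint S₂ z) := by
      refine intervalIntegral.integral_mono_on (hl₁.2 h₁)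
        (TimeScale.intervalIntegrable_comp_lastPoint hc₁ hl₁
          (TimeScale.continuousOn_integral_lastPoint hc₁ hc₂ hl₂ hku hy0) 0 s₁)
        (TimeScale.intervalIntegrable_comp_lastPoint hc₁ hl₁ hcU 0 s₁) fun x _ => ?_
      rw [← intervalIntegral.integral_add_adjacent_intervals
        (hsec hku _ (hm₁ x) 0 (TimeScale.lastPoint S₂ y)) (hsec hku _ (hm₁ x) _ τ)]
      exact le_add_of_nonneg_right (intervalIntegral.integral_nonneg hyle fun z _ =>
        mul_nonneg (hk0 _ (hm₁ x) _ (hm₂ z)) (hu0 _ (hm₁ x) _ (hm₂ z)))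
    have hineq := h s₁ h₁ _ (hm₂ y)
    rw [TimeScale.deltaIntegral_deltaIntegral_eq hc₁ hc₂ hl₁ hl₂ hku h₁ (hm₂ y)] at hineq
    have hineq' := hineq.trans (add_le_add_right
      (mul_le_mul_of_nonneg_left hmono (hq0 s₁ h₁ _ (hm₂ y))) _)
    refine (mul_le_mul_of_nonneg_left hineq' (hk0 s₁ h₁ _ (hm₂ y))).trans (le_of_eq ?_)
    ring
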